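/- **Matrix Bernstein inequality.** Let $d \ge 1$ and let $Y_1, \dots, Y_n$ ($n \ge 0$) be a finite sequence of independent random Hermitian $d \times d$ complex matrices, defined on a common probability space. Let $R \ge 0$, and assume that, for each index $k$, $$\mathbb{E}\, Y_k = 0 \quad\text{and}\quad \|Y_k\| \le R \ \text{ almost surely},$$ where $\|\cdot\|$ is the spectral norm. Put $\sigma \ge 0$, $\sigma^2 := \bigl\| \sum_{k} \mathbb{E}\, Y_k^2 \bigr\|$, and write $\lambda_{\max}$ for the largest eigenvalue of a Hermitian matrix. Then, for all $t \ge 0$, $$\mathbb{P}\Bigl\{ \lambda_{\max}\Bigl(\sum_k Y_k\Bigr) \ge t \Bigr\} \le d \cdot \exp\Bigl\{ \frac{-t^2}{3\sigma^2 + 2Rt} \Bigr\}.$$ (If the denominator vanishes, the exponent is read as $-\infty$ when $t > 0$ and as $0$ when $t = 0$.) Furthermore, $\lambda_{\max}(\sum_k Y_k)$ is integrable and $$\mathbb{E}\, \lambda_{\max}\Bigl(\sum_k Y_k\Bigr) \le \sigma \sqrt{3 \log d} + R \log d.$$ -/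

import Mathlib

open MeasureTheory ProbabilityTheory
-- `‖A‖` for a matrix `A` is the spectral norm (the largest singular value).
open scoped Matrix.Norms.L2Operator

/-- Matrices carry the product σ-algebra of their entries. -/
instance Matrix.instMeasurableSpaceEntries {m n : Type*} {α : Type*} [MeasurableSpace α] :
    MeasurableSpace (Matrix m n α) :=
  inferInstanceAs (MeasurableSpace (m → n → α))

/-- The product σ-algebra is the Borel σ-algebra of the norm topology. -/
instance Matrix.instBorelSpaceEntries {m n : Type*} [Fintype m] [Fintype n] [DecidableEq n] :
    BorelSpace (Matrix m n ℂ) :=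
  inferInstanceAs (BorelSpace (m → n → ℂ))

/-- The largest eigenvalue `λ_max(A)` of a Hermitian matrix `A` of positive size: the maximum of
the (finite, non-empty) set of its real eigenvalues. -/
noncomputable def lambdaMax {d : ℕ} (A : Matrix (Fin d) (Fin d) ℂ) : ℝ :=
  sSup (spectrum ℝ A)

/-!
The matrix Bernstein inequality follows from a bound on the trace exponential
`m θ = 𝔼 tr exp (θ X)`, where `X = ∑ Y_k`: the Chernoff bound (`measureReal_le_lambdaMax_le`) gives
the tail and the concavity of the logarithm (`mul_integral_lambdaMax_le`) gives the mean.

The trace exponential is controlled by the method of exchangeable pairs, which needs neither Lieb's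
concavity theorem nor the Golden–Thompson inequality. The derivative is
`m' θ = ∑ 𝔼 tr Y_k exp (θ X)`. Freeze all summands but `Y = Y_k` at a matrix `h` and let
`Y'` be an independent copy of `Y`. Since `𝔼 Y = 0`, the expectation of `tr Y exp (θ (h + Y))` is
half that of `tr (Y - Y') (exp (θ (h + Y)) - exp (θ (h + Y')))`. The mixed mean value trace inequality
`reTrace_mul_exp_sub_exp_le` for Hermitian `A`, `B`, `C` and `c > 0`,

  `tr C (exp A - exp B) ≤ tr (c (A - B) ^ 2 + C ^ 2 / c) (exp A + exp B) / 4`,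

bounds this by the expectation of `θ / 2 * tr (Y ^ 2 + 𝔼 Y ^ 2) exp (θ (h + Y))`
(`integral_reTrace_mul_exp_le`). The random square `Y ^ 2` is correlated with the exponential. The
same inequality with `C = Y ^ 2 - Y' ^ 2`, together with `C ^ 2 ≤ 2 R ^ 2 (Y ^ 2 + Y' ^ 2)`, shows
that replacing it by its mean costs only a relative error `3 R θ / 4`
(`integral_reTrace_sq_sub_mul_exp_le`). Summing over `k` yields
`(1 - 3 R θ / 4) m' θ ≤ θ σ ^ 2 m θ`, hence `m θ ≤ d exp (σ ^ 2 θ ^ 2 / (2 (1 - 3 R θ / 4)))`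
(`integral_reTrace_exp_le`), and the constants `3 σ ^ 2` and `2 R` leave room to choose `θ`.
This needs `R > 0`; for `R = 0` the sum vanishes almost surely.
-/

/-! ### The real trace and matrix exponentials of Hermitian matrices -/

open Matrix in
/-- The real part of the trace, as a continuous real-linear functional on complex matrices. -/
noncomputable def reTrace (d : ℕ) : Matrix (Fin d) (Fin d) ℂ →L[ℝ] ℝ :=
  LinearMap.toContinuousLinearMap
    (Complex.reLm ∘ₗ (traceLinearMap (Fin d) ℂ ℂ).restrictScalars ℝ)

lemma reTrace_apply {d : ℕ} (A : Matrix (Fin d) (Fin d) ℂ) : reTrace d A = A.trace.re := rfl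

lemma reTrace_mul_comm {d : ℕ} (A B : Matrix (Fin d) (Fin d) ℂ) :
    reTrace d (A * B) = reTrace d (B * A) := by
  rw [reTrace_apply, reTrace_apply, Matrix.trace_mul_comm]

/-- Diagonalization of a Hermitian matrix together with its exponential. -/
lemma Matrix.IsHermitian.exists_unitary_exp {d : ℕ} {A : Matrix (Fin d) (Fin d) ℂ}
    (hA : A.IsHermitian) :
    ∃ U : Matrix (Fin d) (Fin d) ℂ, star U * U = 1 ∧ U * star U = 1 ∧
      A = U * Matrix.diagonal (fun i => (hA.eigenvalues i : ℂ)) * star U ∧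
      NormedSpace.exp A =
        U * Matrix.diagonal (fun i => (Real.exp (hA.eigenvalues i) : ℂ)) * star U := by
  have h1 : star (hA.eigenvectorUnitary : Matrix (Fin d) (Fin d) ℂ) * hA.eigenvectorUnitary = 1 :=
    Unitary.coe_star_mul_self _
  have h2 : (hA.eigenvectorUnitary : Matrix (Fin d) (Fin d) ℂ) * star hA.eigenvectorUnitary.1 = 1 :=
    Unitary.coe_mul_star_self _
  have h3 : A = (hA.eigenvectorUnitary : Matrix (Fin d) (Fin d) ℂ) *
      Matrix.diagonal (fun i => (hA.eigenvalues i : ℂ)) * star hA.eigenvectorUnitary.1 := by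
    conv_lhs => rw [hA.spectral_theorem, Unitary.conjStarAlgAut_apply]
    rfl
  refine ⟨hA.eigenvectorUnitary, h1, h2, h3, ?_⟩
  let u : (Matrix (Fin d) (Fin d) ℂ)ˣ := ⟨_, _, h2, h1⟩
  have := Matrix.exp_units_conj u (Matrix.diagonal (fun i => (hA.eigenvalues i : ℂ)))
  conv_lhs => rw [h3]
  refine this.trans ?_
  rw [Matrix.exp_diagonal]
  simp only [u]
  congr 3
  ext i
  rw [Complex.ofReal_exp, Complex.exp_eq_exp_ℂ, Pi.coe_exp]

lemma reTrace_mul_conj_diagonal {d : ℕ} (C U : Matrix (Fin d) (Fin d) ℂ) (e : Fin d → ℝ) :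
    reTrace d (C * (U * Matrix.diagonal (fun i => (e i : ℂ)) * star U)) =
      ∑ i, ((star U * C * U) i i).re * e i := by
  have : C * (U * Matrix.diagonal (fun i => (e i : ℂ)) * star U) =
    (C * U * Matrix.diagonal (fun i => (e i : ℂ))) * star U := by simp only [mul_assoc]
  rw [this, reTrace_mul_comm, ← mul_assoc, ← mul_assoc, reTrace_apply, Matrix.trace, Complex.re_sum]
  refine Finset.sum_congr rfl fun i _ => ?_
  rw [Matrix.diag_apply, Matrix.mul_diagonal, Complex.re_mul_ofReal]

/-- The difference quotient of `exp` is at most the mean of `exp` at the two endpoints. -/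
lemma Real.abs_exp_sub_exp_le (a b : ℝ) :
    |Real.exp a - Real.exp b| ≤ |a - b| * ((Real.exp a + Real.exp b) / 2) := by
  wlog h : b ≤ a generalizing a b
  · rw [abs_sub_comm, abs_sub_comm a, add_comm]
    exact this b a (le_of_not_ge h)
  have key : ∀ x : ℝ, 0 ≤ x → Real.exp x - 1 ≤ x * ((Real.exp x + 1) / 2) := by
    intro x hx
    have hmono : MonotoneOn (fun x : ℝ => x * ((Real.exp x + 1) / 2) - (Real.exp x - 1))
        (Set.Ici 0) := by
      have hd : ∀ x : ℝ, HasDerivAt (fun x : ℝ => x * ((Real.exp x + 1) / 2) - (Real.exp x - 1))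
          (1 * ((Real.exp x + 1) / 2) + x * (Real.exp x / 2) - Real.exp x) x := fun x =>
        ((hasDerivAt_id x).mul (((Real.hasDerivAt_exp x).add_const 1).div_const 2)).sub
          ((Real.hasDerivAt_exp x).sub_const 1)
      refine monotoneOn_of_deriv_nonneg (convex_Ici 0)
        (fun x _ => (hd x).continuousAt.continuousWithinAt)
        (fun x _ => (hd x).differentiableAt.differentiableWithinAt) fun x _ => ?_
      rw [(hd x).deriv]
      have h1 : 1 - x ≤ Real.exp (-x) := by linarith [Real.add_one_le_exp (-x)]
      have h2 : Real.exp (-x) * Real.exp x = 1 := by rw [← Real.exp_add]; simp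
      nlinarith [Real.exp_pos x]
    have := hmono (Set.mem_Ici.2 le_rfl) (Set.mem_Ici.2 hx) hx
    simp only [Real.exp_zero] at this
    linarith
  have h1 := key (a - b) (by linarith)
  have h2 : Real.exp a = Real.exp (a - b) * Real.exp b := by rw [← Real.exp_add]; ring_nf
  rw [abs_of_nonneg (sub_nonneg.2 (Real.exp_le_exp.2 h)), abs_of_nonneg (by linarith), h2]
  nlinarith [mul_le_mul_of_nonneg_right h1 (Real.exp_pos b).le]

/-- Mixed form of the mean value trace inequality. With `C = A - B` and `c = 1` it bounds
`tr (A - B) (exp A - exp B)` by `tr (A - B) ^ 2 (exp A + exp B) / 2`. In eigenbases of `A` and `B`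
it reduces entrywise to `Real.abs_exp_sub_exp_le`. -/
lemma reTrace_mul_exp_sub_exp_le {d : ℕ} {A B C : Matrix (Fin d) (Fin d) ℂ}
    (hA : A.IsHermitian) (hB : B.IsHermitian) (hC : C.IsHermitian) {c : ℝ} (hc : 0 < c) :
    reTrace d (C * (NormedSpace.exp A - NormedSpace.exp B)) ≤
      1 / 4 * reTrace d ((c • (A - B) ^ 2 + c⁻¹ • C ^ 2) *
        (NormedSpace.exp A + NormedSpace.exp B)) := by
  obtain ⟨U, hU1, hU2, hUA, hUe⟩ := hA.exists_unitary_exp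
  obtain ⟨W, hW1, hW2, hWB, hWe⟩ := hB.exists_unitary_exp
  set a := hA.eigenvalues
  set b := hB.eigenvalues
  set P := star W * U with hP
  set K := star W * C * U with hK
  set E := star W * (A - B) * U with hE
  have hsD : star (A - B) = A - B := hA.sub hB
  have hsC : star C = C := hC
  have hstar : ∀ M : Matrix (Fin d) (Fin d) ℂ, star M = M →
      star U * (M ^ 2) * U = star (star W * M * U) * (star W * M * U) := by
    intro M hM
    rw [star_mul, star_mul, star_star, hM, sq]
    calc star U * (M * M) * U = star U * M * 1 * M * U := by simp only [mul_assoc, one_mul]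
      _ = _ := by rw [← hW2]; simp only [mul_assoc]
  have hstar' : ∀ M : Matrix (Fin d) (Fin d) ℂ, star M = M →
      star W * (M ^ 2) * W = (star W * M * U) * star (star W * M * U) := by
    intro M hM
    rw [star_mul, star_mul, star_star, hM, sq]
    calc star W * (M * M) * W = star W * M * 1 * M * W := by simp only [mul_assoc, one_mul]
      _ = _ := by rw [← hU2]; simp only [mul_assoc]
  have hnsq : ∀ z : ℂ, (star z * z).re = ‖z‖ ^ 2 := fun z => by
    rw [Complex.star_def, ← Complex.normSq_eq_conj_mul_self, Complex.ofReal_re,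
      Complex.normSq_eq_norm_sq]
  have hA2 : ∀ M : Matrix (Fin d) (Fin d) ℂ, star M = M →
      reTrace d (M ^ 2 * NormedSpace.exp A) =
        ∑ j, ∑ i, ‖(star W * M * U) j i‖ ^ 2 * Real.exp (a i) := by
    intro M hM
    rw [hUe, reTrace_mul_conj_diagonal, hstar M hM, Finset.sum_comm]
    refine Finset.sum_congr rfl fun i _ => ?_
    rw [Matrix.mul_apply, Complex.re_sum, Finset.sum_mul]
    refine Finset.sum_congr rfl fun j _ => ?_
    rw [Matrix.star_apply, hnsq]
  have hB2 : ∀ M : Matrix (Fin d) (Fin d) ℂ, star M = M →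
      reTrace d (M ^ 2 * NormedSpace.exp B) =
        ∑ j, ∑ i, ‖(star W * M * U) j i‖ ^ 2 * Real.exp (b j) := by
    intro M hM
    rw [hWe, reTrace_mul_conj_diagonal, hstar' M hM]
    refine Finset.sum_congr rfl fun i _ => ?_
    rw [Matrix.mul_apply, Complex.re_sum, Finset.sum_mul]
    refine Finset.sum_congr rfl fun j _ => ?_
    rw [Matrix.star_apply, mul_comm, mul_comm _ (star _), hnsq, mul_comm]
  have hA1 : reTrace d (C * NormedSpace.exp A) =
      ∑ j, ∑ i, (star (P j i) * K j i).re * Real.exp (a i) := by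
    have h : star U * C * U = star P * K := by
      rw [hP, hK, star_mul, star_star]
      calc star U * C * U = star U * 1 * C * U := by simp only [mul_one]
        _ = _ := by rw [← hW2]; simp only [mul_assoc]
    rw [hUe, reTrace_mul_conj_diagonal, h, Finset.sum_comm]
    refine Finset.sum_congr rfl fun i _ => ?_
    rw [Matrix.mul_apply, Complex.re_sum, Finset.sum_mul]
    rfl
  have hB1 : reTrace d (C * NormedSpace.exp B) =
      ∑ j, ∑ i, (star (P j i) * K j i).re * Real.exp (b j) := by
    have h : star W * C * W = K * star P := by
      rw [hP, hK, star_mul, star_star]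
      calc star W * C * W = star W * C * 1 * W := by simp only [mul_one]
        _ = _ := by rw [← hU2]; simp only [mul_assoc]
    rw [hWe, reTrace_mul_conj_diagonal, h]
    refine Finset.sum_congr rfl fun i _ => ?_
    rw [Matrix.mul_apply, Complex.re_sum, Finset.sum_mul]
    refine Finset.sum_congr rfl fun j _ => ?_
    rw [Matrix.star_apply, mul_comm (K i j)]
  -- In the two eigenbases, `A - B` acts entrywise as multiplication by `a i - b j`.
  have hEji : ∀ j i, ‖E j i‖ = |a i - b j| * ‖P j i‖ := by
    intro j i
    have h : E = P * Matrix.diagonal (fun i => (a i : ℂ)) -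
        Matrix.diagonal (fun i => (b i : ℂ)) * P := by
      rw [hE, mul_sub, sub_mul]
      congr 1
      · conv_lhs => rw [hUA]
        calc _ = star W * U * Matrix.diagonal (fun i => (a i : ℂ)) * (star U * U) := by
              simp only [mul_assoc]
          _ = _ := by rw [hU1, mul_one]
      · conv_lhs => rw [hWB]
        calc _ = (star W * W) * (Matrix.diagonal (fun i => (b i : ℂ)) * (star W * U)) := by
              simp only [mul_assoc]
          _ = _ := by rw [hW1, one_mul]
    rw [h, Matrix.sub_apply, Matrix.mul_diagonal, Matrix.diagonal_mul, mul_comm (P j i),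
      ← sub_mul, norm_mul, ← Complex.ofReal_sub, Complex.norm_real, Real.norm_eq_abs]
  rw [mul_sub, map_sub, hA1, hB1, add_mul, mul_add, mul_add, map_add, map_add, map_add]
  simp only [smul_mul_assoc, map_smul, smul_eq_mul]
  rw [hA2 _ hsD, hB2 _ hsD, hA2 _ hsC, hB2 _ hsC]
  simp only [← Finset.sum_sub_distrib, ← Finset.sum_add_distrib, Finset.mul_sum]
  refine Finset.sum_le_sum fun j _ => Finset.sum_le_sum fun i _ => ?_
  rw [← hE, ← hK, hEji]
  have h1 : (star (P j i) * K j i).re * (Real.exp (a i) - Real.exp (b j)) ≤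
      (‖P j i‖ * ‖K j i‖) * (|a i - b j| * ((Real.exp (a i) + Real.exp (b j)) / 2)) := by
    refine (le_abs_self _).trans ?_
    rw [abs_mul]
    refine mul_le_mul ((Complex.abs_re_le_norm _).trans_eq ?_) (Real.abs_exp_sub_exp_le _ _)
      (abs_nonneg _) (by positivity)
    rw [norm_mul, norm_star]
  have h2 : (|a i - b j| * ‖P j i‖) * ‖K j i‖ ≤
      (c * (|a i - b j| * ‖P j i‖) ^ 2 + c⁻¹ * ‖K j i‖ ^ 2) / 2 := by
    set x := |a i - b j| * ‖P j i‖
    set y := ‖K j i‖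
    have : 0 ≤ c⁻¹ * (c * x - y) ^ 2 := by positivity
    have h3 : c⁻¹ * (c * x - y) ^ 2 = c * x ^ 2 + c⁻¹ * y ^ 2 - 2 * (x * y) := by
      field_simp; ring
    linarith
  have h4 := mul_le_mul_of_nonneg_right h2
    (by positivity : 0 ≤ (Real.exp (a i) + Real.exp (b j)) / 2)
  nlinarith [h1, h4]

lemma reTrace_exp {d : ℕ} {A : Matrix (Fin d) (Fin d) ℂ} (hA : A.IsHermitian) :
    reTrace d (NormedSpace.exp A) = ∑ i, Real.exp (hA.eigenvalues i) := by
  obtain ⟨U, hU1, hU2, hUA, hUe⟩ := hA.exists_unitary_exp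
  have := reTrace_mul_conj_diagonal 1 U (fun i => Real.exp (hA.eigenvalues i))
  rw [one_mul, ← hUe] at this
  rw [this]
  simp [hU1]

/-- Duality of the operator norm and the trace norm, for the positive matrix `exp A`. -/
lemma reTrace_mul_exp_le {d : ℕ} {A : Matrix (Fin d) (Fin d) ℂ} (hA : A.IsHermitian)
    (V : Matrix (Fin d) (Fin d) ℂ) :
    reTrace d (V * NormedSpace.exp A) ≤ ‖V‖ * reTrace d (NormedSpace.exp A) := by
  obtain ⟨U, hU1, hU2, hUA, hUe⟩ := hA.exists_unitary_exp
  rw [reTrace_exp hA, hUe, reTrace_mul_conj_diagonal, Finset.mul_sum]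
  refine Finset.sum_le_sum fun i _ => mul_le_mul_of_nonneg_right ?_ (Real.exp_pos _).le
  have hentry : ∀ M : Matrix (Fin d) (Fin d) ℂ, ‖M i i‖ ≤ ‖M‖ := by
    intro M
    have h1 := Matrix.l2_opNorm_mulVec M (EuclideanSpace.single i 1)
    have h2 := PiLp.norm_apply_le
      (WithLp.toLp 2 (M.mulVec (Pi.single i 1)) : EuclideanSpace ℂ (Fin d)) i
    simp at h1 h2
    exact h2.trans h1
  refine (Complex.re_le_norm _).trans ((hentry _).trans ?_)
  have hU : U ∈ unitary (Matrix (Fin d) (Fin d) ℂ) := ⟨hU1, hU2⟩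
  rw [CStarRing.norm_mul_mem_unitary _ hU, CStarRing.norm_mem_unitary_mul _ (Unitary.star_mem hU)]

open scoped ComplexOrder in
lemma reTrace_mul_exp_nonneg {d : ℕ} {A V : Matrix (Fin d) (Fin d) ℂ} (hA : A.IsHermitian)
    (hV : V.PosSemidef) : 0 ≤ reTrace d (V * NormedSpace.exp A) := by
  obtain ⟨U, hU1, hU2, hUA, hUe⟩ := hA.exists_unitary_exp
  rw [hUe, reTrace_mul_conj_diagonal]
  refine Finset.sum_nonneg fun i _ => mul_nonneg ?_ (Real.exp_pos _).le
  have := (hV.conjTranspose_mul_mul_same U).diag_nonneg (i := i)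
  exact (Complex.le_def.1 this).1

/-! ### The largest eigenvalue -/

open scoped MatrixOrder ComplexOrder in
/-- The largest eigenvalue as a shifted norm; this makes `lambdaMax` continuous on bounded sets of
Hermitian matrices. -/
lemma lambdaMax_eq_norm_add_sub {d : ℕ} (hd : 1 ≤ d) {A : Matrix (Fin d) (Fin d) ℂ}
    (hA : A.IsHermitian) {M : ℝ} (hM : ‖A‖ ≤ M) :
    IsGreatest (spectrum ℝ A) (lambdaMax A) ∧
      lambdaMax A = ‖A + algebraMap ℝ (Matrix (Fin d) (Fin d) ℂ) M‖ - M := by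
  have : Nonempty (Fin d) := ⟨⟨0, hd⟩⟩
  have hsa : IsSelfAdjoint A := hA
  have h0 : 0 ≤ A + algebraMap ℝ (Matrix (Fin d) (Fin d) ℂ) M := by
    have h1 := hsa.neg_algebraMap_norm_le_self
    have h2 : algebraMap ℝ (Matrix (Fin d) (Fin d) ℂ) ‖A‖ ≤ algebraMap ℝ _ M :=
      algebraMap_mono (Matrix (Fin d) (Fin d) ℂ) hM
    exact neg_le_iff_add_nonneg.1 ((neg_le_neg h2).trans h1)
  have hmem : ∀ x, x ∈ spectrum ℝ A ↔
      x + M ∈ spectrum ℝ (A + algebraMap ℝ (Matrix (Fin d) (Fin d) ℂ) M) := fun x => by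
    rw [add_comm A]
    exact (spectrum.add_mem_add_iff (a := A) (r := x) (s := M)).symm
  have hg : IsGreatest (spectrum ℝ A)
      (‖A + algebraMap ℝ (Matrix (Fin d) (Fin d) ℂ) M‖ - M) := by
    refine ⟨?_, fun x hx => ?_⟩
    · rw [hmem, sub_add_cancel]
      exact CStarAlgebra.norm_mem_spectrum_of_nonneg h0
    · have := spectrum.norm_le_norm_of_mem ((hmem x).1 hx)
      linarith [(le_abs_self (x + M)).trans this]
  have h : lambdaMax A = _ := hg.csSup_eq
  exact ⟨h ▸ hg, h⟩

/-- The exponential moment of the largest eigenvalue is dominated by the trace exponential. -/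
lemma exp_mul_lambdaMax_le {d : ℕ} (hd : 1 ≤ d) {A : Matrix (Fin d) (Fin d) ℂ}
    (hA : A.IsHermitian) {θ : ℝ} (hθ : 0 < θ) :
    Real.exp (θ * lambdaMax A) ≤ reTrace d (NormedSpace.exp (θ • A)) := by
  have hθA : (θ • A).IsHermitian := hA.smul (IsSelfAdjoint.all θ)
  have h1 := (lambdaMax_eq_norm_add_sub hd hA le_rfl).1.1
  have h2 : θ * lambdaMax A ∈ spectrum ℝ (θ • A) :=
    spectrum.smul_mem_smul_iff (r := Units.mk0 θ hθ.ne') |>.2 h1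
  rw [hθA.spectrum_real_eq_range_eigenvalues] at h2
  obtain ⟨i, hi⟩ := h2
  rw [reTrace_exp hθA, ← hi]
  exact Finset.single_le_sum (f := fun i => Real.exp (hθA.eigenvalues i))
    (fun j _ => (Real.exp_pos _).le) (Finset.mem_univ i)

/-! ### Exchangeable pairs -/

open scoped MatrixOrder ComplexOrder in
/-- For Hermitian `P`, `Q` of norm at most `R`, operator convexity of the square and
`P ^ 4 ≤ R ^ 2 P ^ 2` give `(P ^ 2 - Q ^ 2) ^ 2 ≤ 2 R ^ 2 (P ^ 2 + Q ^ 2)`. -/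
lemma posSemidef_sq_sub_sq {d : ℕ} {P Q : Matrix (Fin d) (Fin d) ℂ} (hP : P.IsHermitian)
    (hQ : Q.IsHermitian) {R : ℝ} (hPR : ‖P‖ ≤ R) (hQR : ‖Q‖ ≤ R) :
    ((2 * R ^ 2) • (P ^ 2 + Q ^ 2) - (P ^ 2 - Q ^ 2) ^ 2).PosSemidef := by
  have key : ∀ S : Matrix (Fin d) (Fin d) ℂ, S.IsHermitian → ‖S‖ ≤ R →
      (R ^ 2 • S ^ 2 - S ^ 4).PosSemidef := by
    intro S hS hSR
    have h1 : star S * S ≤ algebraMap ℝ _ (R ^ 2) :=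
      CStarAlgebra.star_mul_le_algebraMap_norm_sq.trans
        (algebraMap_mono (Matrix (Fin d) (Fin d) ℂ) (pow_le_pow_left₀ (norm_nonneg _) hSR 2))
    rw [Matrix.le_iff] at h1
    have h2 := h1.conjTranspose_mul_mul_same S
    have h3 : star S = S := hS
    rw [h3, hS.eq] at h2
    have e : S * (algebraMap ℝ (Matrix (Fin d) (Fin d) ℂ) (R ^ 2) - S * S) * S =
        R ^ 2 • S ^ 2 - S ^ 4 := by
      rw [mul_sub, sub_mul, Algebra.algebraMap_eq_smul_one, mul_smul_comm, mul_one, smul_mul_assoc]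
      congr 1
      · rw [sq S]
      · simp only [pow_succ, pow_zero, one_mul, mul_assoc]
    rwa [e] at h2
  have h4 : ((P ^ 2 + Q ^ 2) ^ 2).PosSemidef := by
    have hh : (P ^ 2 + Q ^ 2).IsHermitian := (hP.pow 2).add (hQ.pow 2)
    have := Matrix.posSemidef_conjTranspose_mul_self (P ^ 2 + Q ^ 2)
    rwa [hh.eq, ← sq] at this
  have h5 := (((key P hP hPR).add (key P hP hPR)).add ((key Q hQ hQR).add (key Q hQ hQR))).add h4
  convert h5 using 1
  have e : (P ^ 2 + Q ^ 2) ^ 2 + (P ^ 2 - Q ^ 2) ^ 2 = P ^ 4 + P ^ 4 + (Q ^ 4 + Q ^ 4) := by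
    noncomm_ring
  rw [eq_sub_of_add_eq e, two_mul, add_smul, smul_add]
  abel

lemma integrable_continuous_comp_of_bounded {Ω E F : Type*} [MeasurableSpace Ω] {μ : Measure Ω}
    [IsFiniteMeasure μ] [NormedAddCommGroup E] [ProperSpace E] [NormedAddCommGroup F]
    {Φ : E → F} (hΦ : Continuous Φ) {Z : Ω → E} (hZ : AEStronglyMeasurable Z μ) {r : ℝ}
    (hr : ∀ᵐ ω ∂μ, ‖Z ω‖ ≤ r) : Integrable (fun ω => Φ (Z ω)) μ := by
  obtain ⟨C, hC⟩ := (isCompact_closedBall (0 : E) r).exists_bound_of_continuousOn hΦ.continuousOn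
  refine Integrable.of_bound (hΦ.comp_aestronglyMeasurable hZ) C ?_
  filter_upwards [hr] with ω h
  exact hC _ (mem_closedBall_zero_iff.2 h)

/-- Closed balls of matrices are compact in the operator norm, so that continuous functions of a
bounded random matrix are integrable. -/
instance Matrix.instProperSpaceL2Op {d : ℕ} : ProperSpace (Matrix (Fin d) (Fin d) ℂ) :=
  FiniteDimensional.proper ℂ _

lemma Measurable.aestronglyMeasurable_matrix {d : ℕ} {Ω : Type*} [MeasurableSpace Ω]
    {μ : Measure Ω} {Y : Ω → Matrix (Fin d) (Fin d) ℂ} (hY : Measurable Y) :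
    AEStronglyMeasurable Y μ :=
  haveI : SecondCountableTopology (Matrix (Fin d) (Fin d) ℂ) := secondCountable_of_proper
  hY.aestronglyMeasurable

lemma continuous_matrix_exp {d : ℕ} :
    Continuous (NormedSpace.exp : Matrix (Fin d) (Fin d) ℂ → Matrix (Fin d) (Fin d) ℂ) :=
  let _ : NormedAlgebra ℚ (Matrix (Fin d) (Fin d) ℂ) := NormedAlgebra.restrictScalars ℚ ℂ _
  NormedSpace.exp_continuous

lemma integral_reTrace_mul {d : ℕ} {Ω : Type*} [MeasurableSpace Ω] {μ : Measure Ω}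
    {F : Ω → Matrix (Fin d) (Fin d) ℂ} (hF : Integrable F μ) (E : Matrix (Fin d) (Fin d) ℂ) :
    ∫ ω, reTrace d (F ω * E) ∂μ = reTrace d ((∫ ω, F ω ∂μ) * E) :=
  ((reTrace d).comp
    ((ContinuousLinearMap.mul ℝ (Matrix (Fin d) (Fin d) ℂ)).flip E)).integral_comp_comm hF

/-- Symmetrization: the covariance of `g Y` with the matrix `exp (θ (h + Y))` is bounded through the
mixed mean value trace inequality for the exchangeable pair `(Y, Y')`, where `Y'` is an independent
copy of `Y`. -/
lemma integral_reTrace_sub_mul_exp_le {d : ℕ} {Ω : Type*} [MeasurableSpace Ω] {μ : Measure Ω}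
    [IsProbabilityMeasure μ] {Y : Ω → Matrix (Fin d) (Fin d) ℂ} (hY : Measurable Y)
    (hYh : ∀ ω, (Y ω).IsHermitian) {R : ℝ} (hR : ∀ᵐ ω ∂μ, ‖Y ω‖ ≤ R)
    {h : Matrix (Fin d) (Fin d) ℂ} (hh : h.IsHermitian) {θ : ℝ} (hθ : 0 < θ)
    {g : Matrix (Fin d) (Fin d) ℂ → Matrix (Fin d) (Fin d) ℂ} (hg : Continuous g)
    (hgh : ∀ A, A.IsHermitian → (g A).IsHermitian) {c : ℝ} (hc : 0 < c) :
    ∫ ω, reTrace d ((g (Y ω) - ∫ ω', g (Y ω') ∂μ) * NormedSpace.exp (θ • (h + Y ω))) ∂μ ≤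
      θ / 4 * ∫ ω, ∫ ω', reTrace d ((c • (Y ω - Y ω') ^ 2 + c⁻¹ • (g (Y ω) - g (Y ω')) ^ 2) *
        NormedSpace.exp (θ • (h + Y ω))) ∂μ ∂μ := by
  have hexp := continuous_matrix_exp (d := d)
  have hYm : AEStronglyMeasurable Y μ := hY.aestronglyMeasurable_matrix
  have hZm : AEStronglyMeasurable (fun z : Ω × Ω => (Y z.1, Y z.2)) (μ.prod μ) :=
    hYm.comp_fst.prodMk hYm.comp_snd
  have hZb : ∀ᵐ z ∂(μ.prod μ), ‖(Y z.1, Y z.2)‖ ≤ R := by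
    filter_upwards [Measure.quasiMeasurePreserving_fst.ae hR,
      Measure.quasiMeasurePreserving_snd.ae hR] with z h1 h2
    exact max_le h1 h2
  have hint : ∀ Φ : Matrix (Fin d) (Fin d) ℂ × Matrix (Fin d) (Fin d) ℂ → ℝ, Continuous Φ →
      Integrable (fun z : Ω × Ω => Φ (Y z.1, Y z.2)) (μ.prod μ) := fun Φ hΦ =>
    integrable_continuous_comp_of_bounded hΦ hZm hZb
  set k : Ω × Ω → ℝ := fun z => reTrace d ((g (Y z.1) - g (Y z.2)) *
    NormedSpace.exp (θ • (h + Y z.1))) with hk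
  set q : Ω × Ω → ℝ := fun z => reTrace d ((c • (Y z.1 - Y z.2) ^ 2 +
    c⁻¹ • (g (Y z.1) - g (Y z.2)) ^ 2) * NormedSpace.exp (θ • (h + Y z.1))) with hq
  have hki : Integrable k (μ.prod μ) :=
    hint (fun p => reTrace d ((g p.1 - g p.2) * NormedSpace.exp (θ • (h + p.1)))) (by fun_prop)
  have hqi : Integrable q (μ.prod μ) :=
    hint (fun p => reTrace d ((c • (p.1 - p.2) ^ 2 + c⁻¹ • (g p.1 - g p.2) ^ 2) *
      NormedSpace.exp (θ • (h + p.1)))) (by fun_prop)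
  have hpt : ∀ z : Ω × Ω, k z + k z.swap ≤ θ / 4 * (q z + q z.swap) := by
    intro z
    have hA : ∀ ω, (θ • (h + Y ω)).IsHermitian := fun ω =>
      (hh.add (hYh ω)).smul (IsSelfAdjoint.all θ)
    have := reTrace_mul_exp_sub_exp_le (hA z.1) (hA z.2)
      ((hgh _ (hYh z.1)).sub (hgh _ (hYh z.2))) (div_pos hc hθ)
    have e1 : θ • (h + Y z.1) - θ • (h + Y z.2) = θ • (Y z.1 - Y z.2) := by
      rw [← smul_sub]; congr 1; abel
    have e2 : (c / θ) • (θ • (Y z.1 - Y z.2)) ^ 2 + (c / θ)⁻¹ • (g (Y z.1) - g (Y z.2)) ^ 2 =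
        θ • (c • (Y z.1 - Y z.2) ^ 2 + c⁻¹ • (g (Y z.1) - g (Y z.2)) ^ 2) := by
      rw [smul_pow, smul_smul, smul_add, smul_smul, smul_smul]
      congr 2 <;> field_simp
    -- The parameter `c / θ` absorbs the factor `θ ^ 2` of the squared difference of exponents.
    rw [e1, e2, smul_mul_assoc, map_smul, smul_eq_mul, mul_add, map_add] at this
    have e3 : k z + k z.swap = reTrace d ((g (Y z.1) - g (Y z.2)) *
        (NormedSpace.exp (θ • (h + Y z.1)) - NormedSpace.exp (θ • (h + Y z.2)))) := by
      simp only [hk, Prod.fst_swap, Prod.snd_swap]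
      rw [← map_add]
      congr 1
      noncomm_ring
    have e4 : q z.swap = reTrace d ((c • (Y z.1 - Y z.2) ^ 2 +
        c⁻¹ • (g (Y z.1) - g (Y z.2)) ^ 2) * NormedSpace.exp (θ • (h + Y z.2))) := by
      simp only [hq, Prod.fst_swap, Prod.snd_swap]
      rw [← neg_sub (Y z.1), neg_sq, ← neg_sub (g (Y z.1)), neg_sq]
    rw [e3, e4]
    linarith
  have hmono := integral_mono (hki.add hki.swap) ((hqi.add hqi.swap).const_mul (θ / 4)) hpt
  rw [integral_const_mul] at hmono
  have hks : Integrable (fun z => k z.swap) (μ.prod μ) := hki.swap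
  have hqs : Integrable (fun z => q z.swap) (μ.prod μ) := hqi.swap
  simp only [Pi.add_apply, Function.comp_apply] at hmono
  rw [integral_add hki hks, integral_add hqi hqs] at hmono
  rw [integral_prod_swap k, integral_prod_swap q] at hmono
  have hkq : ∫ z, k z ∂(μ.prod μ) ≤ θ / 4 * ∫ z, q z ∂(μ.prod μ) := by linarith
  rw [integral_prod _ hki, integral_prod _ hqi] at hkq
  refine le_trans (le_of_eq ?_) hkq
  refine integral_congr_ae (.of_forall fun ω => ?_)
  have hgi : Integrable (fun ω' => g (Y ω')) μ := integrable_continuous_comp_of_bounded hg hYm hR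
  have hgs : Integrable (fun ω' => g (Y ω) - g (Y ω')) μ := (integrable_const _).sub hgi
  simp only [hk]
  rw [integral_reTrace_mul hgs, integral_sub (integrable_const _) hgi,
    integral_const, probReal_univ, one_smul]

lemma integral_sq_sub_of_integral_eq_zero {d : ℕ} {Ω : Type*} [MeasurableSpace Ω] {μ : Measure Ω}
    [IsProbabilityMeasure μ] {Y : Ω → Matrix (Fin d) (Fin d) ℂ} (hY : Integrable Y μ)
    (hY2 : Integrable (fun ω => Y ω ^ 2) μ) (h0 : ∫ ω, Y ω ∂μ = 0)
    (A : Matrix (Fin d) (Fin d) ℂ) :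
    ∫ ω, (A - Y ω) ^ 2 ∂μ = A ^ 2 + ∫ ω, Y ω ^ 2 ∂μ := by
  have h1 : ∫ ω, A * Y ω ∂μ = 0 := by
    have := (ContinuousLinearMap.mul ℝ (Matrix (Fin d) (Fin d) ℂ) A).integral_comp_comm hY
    simpa [h0] using this
  have h2 : ∫ ω, Y ω * A ∂μ = 0 := by
    have := ((ContinuousLinearMap.mul ℝ (Matrix (Fin d) (Fin d) ℂ)).flip A).integral_comp_comm hY
    simpa [h0] using this
  have e : ∀ ω, (A - Y ω) ^ 2 = A ^ 2 - A * Y ω - Y ω * A + Y ω ^ 2 := fun ω => by noncomm_ring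
  have i1 : Integrable (fun ω => A * Y ω) μ := hY.const_mul A
  have i2 : Integrable (fun ω => Y ω * A) μ := hY.mul_const A
  have i3 : Integrable (fun ω => A ^ 2 - A * Y ω) μ := (integrable_const _).sub i1
  have i4 : Integrable (fun ω => A ^ 2 - A * Y ω - Y ω * A) μ := i3.sub i2
  simp only [e]
  rw [integral_add i4 hY2, integral_sub i3 i2, integral_sub (integrable_const _) i1, h1, h2]
  simp

/-- With the remaining summands frozen at `h`, the contribution of `Y` to the derivative of the
trace exponential is controlled by its conditional variance `(Y ^ 2 + 𝔼 Y ^ 2) / 2`. -/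
lemma integral_reTrace_mul_exp_le {d : ℕ} {Ω : Type*} [MeasurableSpace Ω] {μ : Measure Ω}
    [IsProbabilityMeasure μ] {Y : Ω → Matrix (Fin d) (Fin d) ℂ} (hY : Measurable Y)
    (hYh : ∀ ω, (Y ω).IsHermitian) {R : ℝ} (hR : ∀ᵐ ω ∂μ, ‖Y ω‖ ≤ R) (h0 : ∫ ω, Y ω ∂μ = 0)
    {h : Matrix (Fin d) (Fin d) ℂ} (hh : h.IsHermitian) {θ : ℝ} (hθ : 0 < θ) :
    ∫ ω, reTrace d (Y ω * NormedSpace.exp (θ • (h + Y ω))) ∂μ ≤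
      θ / 2 * ∫ ω, reTrace d ((Y ω ^ 2 + ∫ ω', Y ω' ^ 2 ∂μ) *
        NormedSpace.exp (θ • (h + Y ω))) ∂μ := by
  have hYm : AEStronglyMeasurable Y μ := hY.aestronglyMeasurable_matrix
  have hYi : Integrable Y μ := integrable_continuous_comp_of_bounded continuous_id hYm hR
  have hY2 : Integrable (fun ω => Y ω ^ 2) μ :=
    integrable_continuous_comp_of_bounded (continuous_pow 2) hYm hR
  have := integral_reTrace_sub_mul_exp_le hY hYh hR hh hθ continuous_id (fun A hA => hA) one_pos
  simp only [id, h0, sub_zero, inv_one, one_smul] at this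
  refine this.trans_eq ?_
  have e : ∀ ω, ∫ ω', reTrace d (((Y ω - Y ω') ^ 2 + (Y ω - Y ω') ^ 2) *
      NormedSpace.exp (θ • (h + Y ω))) ∂μ =
      2 * reTrace d ((Y ω ^ 2 + ∫ ω', Y ω' ^ 2 ∂μ) * NormedSpace.exp (θ • (h + Y ω))) := by
    intro ω
    have hi : Integrable (fun ω' => (Y ω - Y ω') ^ 2) μ :=
      integrable_continuous_comp_of_bounded (Φ := fun y => (Y ω - y) ^ 2) (by fun_prop) hYm hR
    have hii : Integrable (fun ω' => (Y ω - Y ω') ^ 2 + (Y ω - Y ω') ^ 2) μ := hi.add hi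
    rw [integral_reTrace_mul hii, integral_add hi hi,
      integral_sq_sub_of_integral_eq_zero hYi hY2 h0, add_mul, map_add, two_mul]
  simp only [e, integral_const_mul]
  ring

/-- With the remaining summands frozen at `h`, the random square `Y ^ 2` may be replaced by its
mean at the cost of a relative error `3 R θ / 4`. -/
lemma integral_reTrace_sq_sub_mul_exp_le {d : ℕ} {Ω : Type*} [MeasurableSpace Ω] {μ : Measure Ω}
    [IsProbabilityMeasure μ] {Y : Ω → Matrix (Fin d) (Fin d) ℂ} (hY : Measurable Y)
    (hYh : ∀ ω, (Y ω).IsHermitian) {R : ℝ} (hR0 : 0 < R) (hR : ∀ᵐ ω ∂μ, ‖Y ω‖ ≤ R)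
    (h0 : ∫ ω, Y ω ∂μ = 0)
    {h : Matrix (Fin d) (Fin d) ℂ} (hh : h.IsHermitian) {θ : ℝ} (hθ : 0 < θ) :
    ∫ ω, reTrace d ((Y ω ^ 2 - ∫ ω', Y ω' ^ 2 ∂μ) * NormedSpace.exp (θ • (h + Y ω))) ∂μ ≤
      3 * R / 4 * θ * ∫ ω, reTrace d ((Y ω ^ 2 + ∫ ω', Y ω' ^ 2 ∂μ) *
        NormedSpace.exp (θ • (h + Y ω))) ∂μ := by
  have hexp := continuous_matrix_exp (d := d)
  have hYm : AEStronglyMeasurable Y μ := hY.aestronglyMeasurable_matrix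
  have hYi : Integrable Y μ := integrable_continuous_comp_of_bounded continuous_id hYm hR
  have hY2 : Integrable (fun ω => Y ω ^ 2) μ :=
    integrable_continuous_comp_of_bounded (continuous_pow 2) hYm hR
  refine (integral_reTrace_sub_mul_exp_le hY hYh hR hh hθ (continuous_pow 2)
    (fun A hA => hA.pow 2) hR0).trans ?_
  have e : ∀ᵐ ω ∂μ, ∫ ω', reTrace d ((R • (Y ω - Y ω') ^ 2 + R⁻¹ • (Y ω ^ 2 - Y ω' ^ 2) ^ 2) *
      NormedSpace.exp (θ • (h + Y ω))) ∂μ ≤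
      3 * R * reTrace d ((Y ω ^ 2 + ∫ ω', Y ω' ^ 2 ∂μ) * NormedSpace.exp (θ • (h + Y ω))) := by
    filter_upwards [hR] with ω hω
    have hA : (θ • (h + Y ω)).IsHermitian := (hh.add (hYh ω)).smul (IsSelfAdjoint.all θ)
    have hi : Integrable (fun ω' => (Y ω - Y ω') ^ 2) μ :=
      integrable_continuous_comp_of_bounded (Φ := fun y => (Y ω - y) ^ 2) (by fun_prop) hYm hR
    have hi2 : Integrable (fun ω' => Y ω ^ 2 + Y ω' ^ 2) μ := (integrable_const _).add hY2
    have e1 : 3 * R * reTrace d ((Y ω ^ 2 + ∫ ω', Y ω' ^ 2 ∂μ) * NormedSpace.exp (θ • (h + Y ω))) =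
        ∫ ω', reTrace d ((R • (Y ω - Y ω') ^ 2 + (2 * R) • (Y ω ^ 2 + Y ω' ^ 2)) *
          NormedSpace.exp (θ • (h + Y ω))) ∂μ := by
      have j1 : Integrable (fun ω' => R • (Y ω - Y ω') ^ 2) μ := hi.smul R
      have j2 : Integrable (fun ω' => (2 * R) • (Y ω ^ 2 + Y ω' ^ 2)) μ := hi2.smul (2 * R)
      have j3 : Integrable (fun ω' => R • (Y ω - Y ω') ^ 2 + (2 * R) • (Y ω ^ 2 + Y ω' ^ 2)) μ :=
        j1.add j2
      rw [integral_reTrace_mul j3, integral_add j1 j2, integral_smul, integral_smul,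
        integral_sq_sub_of_integral_eq_zero hYi hY2 h0, integral_add (integrable_const _) hY2,
        integral_const, probReal_univ, one_smul, ← add_smul, smul_mul_assoc, map_smul, smul_eq_mul]
      ring
    rw [e1]
    refine integral_mono_ae ?_ ?_ ?_
    · exact integrable_continuous_comp_of_bounded (Φ := fun y =>
        reTrace d ((R • (Y ω - y) ^ 2 + R⁻¹ • (Y ω ^ 2 - y ^ 2) ^ 2) *
          NormedSpace.exp (θ • (h + Y ω)))) (by fun_prop) hYm hR
    · exact integrable_continuous_comp_of_bounded (Φ := fun y =>
        reTrace d ((R • (Y ω - y) ^ 2 + (2 * R) • (Y ω ^ 2 + y ^ 2)) *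
          NormedSpace.exp (θ • (h + Y ω)))) (by fun_prop) hYm hR
    · filter_upwards [hR] with ω' hω'
      have hp := reTrace_mul_exp_nonneg hA (posSemidef_sq_sub_sq (hYh ω) (hYh ω') hω hω')
      rw [sub_mul, map_sub, smul_mul_assoc, map_smul, smul_eq_mul] at hp
      simp only [add_mul, smul_mul_assoc, map_add, map_smul, smul_eq_mul] at hp ⊢
      have h3 := mul_nonneg (inv_nonneg.2 hR0.le) hp
      rw [mul_sub, ← mul_assoc, show R⁻¹ * (2 * R ^ 2) = 2 * R by field_simp] at h3
      linarith
  have hmono := integral_mono_ae ?_ ?_ e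
  · rw [integral_const_mul] at hmono
    calc _ ≤ θ / 4 * _ := mul_le_mul_of_nonneg_left hmono (by positivity)
      _ = _ := by ring
  · have hZm : AEStronglyMeasurable (fun z : Ω × Ω => (Y z.1, Y z.2)) (μ.prod μ) :=
      hYm.comp_fst.prodMk hYm.comp_snd
    have hZb : ∀ᵐ z ∂(μ.prod μ), ‖(Y z.1, Y z.2)‖ ≤ R := by
      filter_upwards [Measure.quasiMeasurePreserving_fst.ae hR,
        Measure.quasiMeasurePreserving_snd.ae hR] with z h1 h2
      exact max_le h1 h2
    exact (integrable_continuous_comp_of_bounded (Φ := fun p : Matrix (Fin d) (Fin d) ℂ ×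
      Matrix (Fin d) (Fin d) ℂ => reTrace d ((R • (p.1 - p.2) ^ 2 + R⁻¹ • (p.1 ^ 2 - p.2 ^ 2) ^ 2) *
        NormedSpace.exp (θ • (h + p.1)))) (by fun_prop) hZm hZb).integral_prod_left
  · exact (integrable_continuous_comp_of_bounded (Φ := fun y =>
      reTrace d ((y ^ 2 + ∫ ω', Y ω' ^ 2 ∂μ) * NormedSpace.exp (θ • (h + y))))
        (by fun_prop) hYm hR).const_mul _

/-! ### The matrix moment generating function of a sum -/

/-- Freezing lemma: a nonnegative expectation for each frozen value of `H` stays nonnegative for `H`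
independent of `X`. No integrability is needed, as the integral of a non-integrable function is
`0`. -/
lemma integral_comp_nonneg_of_indepFun {Ω α β : Type*} [MeasurableSpace Ω] {μ : Measure Ω}
    [IsProbabilityMeasure μ] [MeasurableSpace α] [MeasurableSpace β] {X : Ω → α} {H : Ω → β}
    (hX : Measurable X) (hH : Measurable H) (hind : IndepFun X H μ) {f : α × β → ℝ}
    (hf : Measurable f) (hpos : ∀ ω', 0 ≤ ∫ ω, f (X ω, H ω') ∂μ) :
    0 ≤ ∫ ω, f (X ω, H ω) ∂μ := by
  have hXH : ∫ ω, f (X ω, H ω) ∂μ = ∫ z, f z ∂((μ.map X).prod (μ.map H)) := by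
    rw [← (indepFun_iff_map_prod_eq_prod_map_map hX.aemeasurable hH.aemeasurable).1 hind,
      integral_map (hX.prodMk hH).aemeasurable hf.aestronglyMeasurable]
  have := Measure.isProbabilityMeasure_map hX.aemeasurable (μ := μ)
  have := Measure.isProbabilityMeasure_map hH.aemeasurable (μ := μ)
  rw [hXH]
  by_cases hi : Integrable f ((μ.map X).prod (μ.map H))
  · rw [integral_prod_symm _ hi, integral_map hH.aemeasurable
      hi.integral_prod_right.aestronglyMeasurable]
    refine integral_nonneg fun ω' => ?_
    have hfm : Measurable fun x => f (x, H ω') := hf.comp measurable_prodMk_right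
    simp only [Pi.zero_apply]
    rw [integral_map hX.aemeasurable hfm.aestronglyMeasurable]
    exact hpos ω'
  · rw [integral_undef hi]

/-- Differentiation of the trace exponential under the integral sign; on the compact set
`|s - θ| ≤ 1`, `‖x‖ ≤ B` the derivative is bounded. -/
lemma hasDerivAt_integral_reTrace_exp {d : ℕ} {Ω : Type*} [MeasurableSpace Ω] {μ : Measure Ω}
    [IsProbabilityMeasure μ] {X : Ω → Matrix (Fin d) (Fin d) ℂ} (hX : Measurable X) {B : ℝ}
    (hB : ∀ᵐ ω ∂μ, ‖X ω‖ ≤ B) (θ : ℝ) :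
    HasDerivAt (fun s => ∫ ω, reTrace d (NormedSpace.exp (s • X ω)) ∂μ)
      (∫ ω, reTrace d (X ω * NormedSpace.exp (θ • X ω)) ∂μ) θ := by
  have hexp := continuous_matrix_exp (d := d)
  have hXm : AEStronglyMeasurable X μ := hX.aestronglyMeasurable_matrix
  have hc : Continuous fun p : ℝ × Matrix (Fin d) (Fin d) ℂ =>
      reTrace d (p.2 * NormedSpace.exp (p.1 • p.2)) := by fun_prop
  obtain ⟨C, hC⟩ := ((isCompact_closedBall θ 1).prod (isCompact_closedBall
    (0 : Matrix (Fin d) (Fin d) ℂ) B)).exists_bound_of_continuousOn hc.continuousOn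
  refine (hasDerivAt_integral_of_dominated_loc_of_deriv_le (Metric.closedBall_mem_nhds θ one_pos)
    (bound := fun _ => C) (F' := fun s ω => reTrace d (X ω * NormedSpace.exp (s • X ω)))
    (.of_forall fun s => ?_) ?_ ?_ ?_ (integrable_const _) (.of_forall fun ω s _ => ?_)).2
  · exact (show Continuous fun x : Matrix (Fin d) (Fin d) ℂ => reTrace d (NormedSpace.exp (s • x))
      by fun_prop).comp_aestronglyMeasurable hXm
  · exact integrable_continuous_comp_of_bounded
      (Φ := fun x => reTrace d (NormedSpace.exp (θ • x))) (by fun_prop) hXm hB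
  · exact (show Continuous fun x : Matrix (Fin d) (Fin d) ℂ =>
      reTrace d (x * NormedSpace.exp (θ • x)) by fun_prop).comp_aestronglyMeasurable hXm
  · filter_upwards [hB] with ω hω s hs
    exact hC (s, X ω) ⟨hs, mem_closedBall_zero_iff.2 hω⟩
  · let _ : NormedAlgebra ℚ (Matrix (Fin d) (Fin d) ℂ) := NormedAlgebra.restrictScalars ℚ ℂ _
    exact (reTrace d).hasFDerivAt.comp_hasDerivAt s (hasDerivAt_exp_smul_const' (X ω) s)

lemma ae_norm_sum_le {d n : ℕ} {Ω : Type*} [MeasurableSpace Ω] {μ : Measure Ω}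
    {Y : Fin n → Ω → Matrix (Fin d) (Fin d) ℂ} {R : ℝ} (hbdd : ∀ k, ∀ᵐ ω ∂μ, ‖Y k ω‖ ≤ R) :
    ∀ᵐ ω ∂μ, ‖∑ k, Y k ω‖ ≤ n * R := by
  filter_upwards [ae_all_iff.2 hbdd] with ω h
  simpa using norm_sum_le_of_le Finset.univ fun k _ => h k

/-- The differential inequality for the trace exponential `m θ = 𝔼 tr exp (θ X)` of a sum `X` of
independent matrices: `(1 - 3 R θ / 4) m' θ ≤ θ ‖∑ 𝔼 Y_k ^ 2‖ m θ`. -/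
lemma integral_reTrace_sum_mul_exp_le {d n : ℕ} {Ω : Type*} [MeasurableSpace Ω] {μ : Measure Ω}
    [IsProbabilityMeasure μ] {Y : Fin n → Ω → Matrix (Fin d) (Fin d) ℂ}
    (hmeas : ∀ k, Measurable (Y k)) (hherm : ∀ k ω, (Y k ω).IsHermitian)
    (hindep : iIndepFun Y μ) (hmean : ∀ k, ∫ ω, Y k ω ∂μ = 0)
    {R : ℝ} (hR : 0 < R) (hbdd : ∀ k, ∀ᵐ ω ∂μ, ‖Y k ω‖ ≤ R) {θ : ℝ} (hθ : 0 < θ)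
    (hθR : 3 * R / 4 * θ ≤ 1) :
    (1 - 3 * R / 4 * θ) *
        ∫ ω, reTrace d ((∑ k, Y k ω) * NormedSpace.exp (θ • ∑ k, Y k ω)) ∂μ ≤
      θ * ‖∑ k, ∫ ω, Y k ω ^ 2 ∂μ‖ * ∫ ω, reTrace d (NormedSpace.exp (θ • ∑ k, Y k ω)) ∂μ := by
  have hexp := continuous_matrix_exp (d := d)
  have : SecondCountableTopology (Matrix (Fin d) (Fin d) ℂ) := secondCountable_of_proper
  set X : Ω → Matrix (Fin d) (Fin d) ℂ := fun ω => ∑ k, Y k ω with hXdef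
  have hX : Measurable X := Finset.measurable_fun_sum _ fun k _ => hmeas k
  have hXh : ∀ ω, (X ω).IsHermitian := fun ω =>
    isSelfAdjoint_sum _ (fun k _ => hherm k ω)
  have hXb : ∀ᵐ ω ∂μ, ‖X ω‖ ≤ n * R := ae_norm_sum_le hbdd
  have hθX : ∀ ω, (θ • X ω).IsHermitian := fun ω => (hXh ω).smul (IsSelfAdjoint.all θ)
  set V : Fin n → Matrix (Fin d) (Fin d) ℂ := fun k => ∫ ω, Y k ω ^ 2 ∂μ with hV
  have hint : ∀ k, ∀ Φ : Matrix (Fin d) (Fin d) ℂ × Matrix (Fin d) (Fin d) ℂ → ℝ, Continuous Φ →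
      Integrable (fun ω => Φ (Y k ω, X ω)) μ := by
    intro k Φ hΦ
    refine integrable_continuous_comp_of_bounded hΦ (r := max R (n * R))
      ((hmeas k).prodMk hX).aestronglyMeasurable ?_
    filter_upwards [hbdd k, hXb] with ω h1 h2
    exact max_le_max h1 h2
  have ia : ∀ k, Integrable (fun ω => reTrace d (Y k ω * NormedSpace.exp (θ • X ω))) μ := fun k =>
    hint k (fun p => reTrace d (p.1 * NormedSpace.exp (θ • p.2))) (by fun_prop)
  have iq : ∀ k, Integrable (fun ω => reTrace d (Y k ω ^ 2 * NormedSpace.exp (θ • X ω))) μ :=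
    fun k => hint k (fun p => reTrace d (p.1 ^ 2 * NormedSpace.exp (θ • p.2))) (by fun_prop)
  have ip : ∀ W : Matrix (Fin d) (Fin d) ℂ,
      Integrable (fun ω => reTrace d (W * NormedSpace.exp (θ • X ω))) μ := fun W =>
    integrable_continuous_comp_of_bounded
      (Φ := fun x => reTrace d (W * NormedSpace.exp (θ • x))) (by fun_prop)
      hX.aestronglyMeasurable hXb
  set a : Fin n → ℝ := fun k => ∫ ω, reTrace d (Y k ω * NormedSpace.exp (θ • X ω)) ∂μ with ha
  set q : Fin n → ℝ := fun k => ∫ ω, reTrace d (Y k ω ^ 2 * NormedSpace.exp (θ • X ω)) ∂μ with hq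
  set p : Fin n → ℝ := fun k => ∫ ω, reTrace d (V k * NormedSpace.exp (θ • X ω)) ∂μ with hp
  -- The sum of the other summands is independent of `Y k`.
  have hsplit : ∀ k, ∃ H : Ω → Matrix (Fin d) (Fin d) ℂ, Measurable H ∧
      (∀ ω, (H ω).IsHermitian) ∧ IndepFun (Y k) H μ ∧ ∀ ω, X ω = H ω + Y k ω := by
    intro k
    refine ⟨∑ j ∈ Finset.univ.erase k, Y j, ?_, fun ω => ?_,
      (hindep.indepFun_finsetSum_of_notMem hmeas (Finset.notMem_erase _ _)).symm,
      fun ω => ?_⟩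
    · rw [Finset.sum_fn]
      exact Finset.measurable_fun_sum _ fun j _ => hmeas j
    · rw [Finset.sum_apply]
      exact isSelfAdjoint_sum _ (fun j _ => hherm j ω)
    · rw [Finset.sum_apply, hXdef]
      exact (Finset.sum_erase_add _ _ (Finset.mem_univ k)).symm
  have iqp : ∀ k, Integrable (fun ω => reTrace d (Y k ω ^ 2 * NormedSpace.exp (θ • X ω)) +
      reTrace d (V k * NormedSpace.exp (θ • X ω))) μ := fun k => (iq k).add (ip (V k))
  have iqm : ∀ k, Integrable (fun ω => reTrace d (Y k ω ^ 2 * NormedSpace.exp (θ • X ω)) -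
      reTrace d (V k * NormedSpace.exp (θ • X ω))) μ := fun k => (iq k).sub (ip (V k))
  have hak : ∀ k, a k ≤ θ / 2 * (q k + p k) := by
    intro k
    obtain ⟨H, hH, hHh, hHi, hXH⟩ := hsplit k
    have key := integral_comp_nonneg_of_indepFun (hmeas k) hH hHi
      (f := fun z => θ / 2 * reTrace d ((z.1 ^ 2 + V k) * NormedSpace.exp (θ • (z.2 + z.1))) -
        reTrace d (z.1 * NormedSpace.exp (θ • (z.2 + z.1))))
      (Continuous.measurable (by fun_prop)) ?_
    · simp only [← hXH, add_mul, map_add] at key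
      rw [integral_sub ((iqp k).const_mul _) (ia k), integral_const_mul,
        integral_add (iq k) (ip (V k))] at key
      exact sub_nonneg.1 key
    · intro ω'
      rw [integral_sub, integral_const_mul]
      · exact sub_nonneg.2 (integral_reTrace_mul_exp_le (hmeas k) (hherm k) (hbdd k) (hmean k)
          (hHh ω') hθ)
      · exact (integrable_continuous_comp_of_bounded (Φ := fun y =>
          reTrace d ((y ^ 2 + V k) * NormedSpace.exp (θ • (H ω' + y))))
          (by fun_prop) (hmeas k).aestronglyMeasurable (hbdd k)).const_mul _
      · exact integrable_continuous_comp_of_bounded (Φ := fun y =>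
          reTrace d (y * NormedSpace.exp (θ • (H ω' + y))))
          (by fun_prop) (hmeas k).aestronglyMeasurable (hbdd k)
  have hqk : ∀ k, q k - p k ≤ 3 * R / 4 * θ * (q k + p k) := by
    intro k
    obtain ⟨H, hH, hHh, hHi, hXH⟩ := hsplit k
    have key := integral_comp_nonneg_of_indepFun (hmeas k) hH hHi
      (f := fun z => 3 * R / 4 * θ * reTrace d ((z.1 ^ 2 + V k) *
        NormedSpace.exp (θ • (z.2 + z.1))) -
        reTrace d ((z.1 ^ 2 - V k) * NormedSpace.exp (θ • (z.2 + z.1))))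
      (Continuous.measurable (by fun_prop)) ?_
    · simp only [← hXH, add_mul, sub_mul, map_add, map_sub] at key
      rw [integral_sub ((iqp k).const_mul _) (iqm k),
        integral_const_mul, integral_add (iq k) (ip (V k)), integral_sub (iq k) (ip (V k))] at key
      exact sub_nonneg.1 key
    · intro ω'
      rw [integral_sub, integral_const_mul]
      · exact sub_nonneg.2 (integral_reTrace_sq_sub_mul_exp_le (hmeas k) (hherm k) hR (hbdd k)
          (hmean k) (hHh ω') hθ)
      · exact (integrable_continuous_comp_of_bounded (Φ := fun y =>
          reTrace d ((y ^ 2 + V k) * NormedSpace.exp (θ • (H ω' + y))))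
          (by fun_prop) (hmeas k).aestronglyMeasurable (hbdd k)).const_mul _
      · exact integrable_continuous_comp_of_bounded (Φ := fun y =>
          reTrace d ((y ^ 2 - V k) * NormedSpace.exp (θ • (H ω' + y))))
          (by fun_prop) (hmeas k).aestronglyMeasurable (hbdd k)
  have hsa : ∫ ω, reTrace d (X ω * NormedSpace.exp (θ • X ω)) ∂μ = ∑ k, a k := by
    rw [ha, ← integral_finsetSum _ fun k _ => ia k]
    refine integral_congr_ae (.of_forall fun ω => ?_)
    simp only
    rw [← map_sum, ← Finset.sum_mul]
  have hsp : ∑ k, p k ≤ ‖∑ k, V k‖ * ∫ ω, reTrace d (NormedSpace.exp (θ • X ω)) ∂μ := by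
    rw [hp, ← integral_finsetSum _ fun k _ => ip (V k), ← integral_const_mul]
    refine integral_mono (integrable_finsetSum _ fun k _ => ip (V k)) ?_ fun ω => ?_
    · have := ip 1
      simp only [one_mul] at this
      exact this.const_mul _
    · simp only
      rw [← map_sum, ← Finset.sum_mul]
      exact reTrace_mul_exp_le (hθX ω) _
  have h1 : ∑ k, a k ≤ θ / 2 * (∑ k, q k + ∑ k, p k) := by
    rw [← Finset.sum_add_distrib, Finset.mul_sum]
    exact Finset.sum_le_sum fun k _ => hak k
  have h2 : ∑ k, q k - ∑ k, p k ≤ 3 * R / 4 * θ * (∑ k, q k + ∑ k, p k) := by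
    rw [← Finset.sum_add_distrib, ← Finset.sum_sub_distrib, Finset.mul_sum]
    exact Finset.sum_le_sum fun k _ => hqk k
  rw [hsa]
  have h3 := mul_le_mul_of_nonneg_left h1 (sub_nonneg.2 hθR)
  have h4 := mul_le_mul_of_nonneg_left hsp hθ.le
  have h5 := mul_le_mul_of_nonneg_left h2 (half_pos hθ).le
  linarith

/-- The bound on the trace exponential, obtained by integrating the differential inequality with
the factor `1 - 3 R s / 4` replaced by its value at the right endpoint. -/
lemma integral_reTrace_exp_le {d n : ℕ} {Ω : Type*} [MeasurableSpace Ω] {μ : Measure Ω}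
    [IsProbabilityMeasure μ] {Y : Fin n → Ω → Matrix (Fin d) (Fin d) ℂ}
    (hmeas : ∀ k, Measurable (Y k)) (hherm : ∀ k ω, (Y k ω).IsHermitian)
    (hindep : iIndepFun Y μ) (hmean : ∀ k, ∫ ω, Y k ω ∂μ = 0)
    {R : ℝ} (hR : 0 < R) (hbdd : ∀ k, ∀ᵐ ω ∂μ, ‖Y k ω‖ ≤ R) {θ : ℝ} (hθ : 0 ≤ θ)
    (hθR : 3 * R / 4 * θ < 1) :
    ∫ ω, reTrace d (NormedSpace.exp (θ • ∑ k, Y k ω)) ∂μ ≤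
      d * Real.exp (‖∑ k, ∫ ω, Y k ω ^ 2 ∂μ‖ * θ ^ 2 / (2 * (1 - 3 * R / 4 * θ))) := by
  have : SecondCountableTopology (Matrix (Fin d) (Fin d) ℂ) := secondCountable_of_proper
  set X : Ω → Matrix (Fin d) (Fin d) ℂ := fun ω => ∑ k, Y k ω with hXdef
  have hX : Measurable X := Finset.measurable_fun_sum _ fun k _ => hmeas k
  have hXh : ∀ ω, (X ω).IsHermitian := fun ω => isSelfAdjoint_sum _ (fun k _ => hherm k ω)
  have hXb : ∀ᵐ ω ∂μ, ‖X ω‖ ≤ n * R := ae_norm_sum_le hbdd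
  set m : ℝ → ℝ := fun s => ∫ ω, reTrace d (NormedSpace.exp (s • X ω)) ∂μ with hm
  set v := ‖∑ k, ∫ ω, Y k ω ^ 2 ∂μ‖ with hv
  have hv0 : 0 ≤ v := norm_nonneg _
  set κ := 3 * R / 4 with hκ
  have hκ0 : 0 < κ := by positivity
  have hpos : 0 < 1 - κ * θ := sub_pos.2 hθR
  set w := v / (1 - κ * θ) with hw
  have hm0 : ∀ s, 0 ≤ m s := fun s => integral_nonneg fun ω => by
    simp only
    rw [reTrace_exp ((hXh ω).smul (IsSelfAdjoint.all s))]
    exact Finset.sum_nonneg fun i _ => (Real.exp_pos _).le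
  have hd : ∀ s, HasDerivAt (fun s => m s * Real.exp (-(w * s ^ 2 / 2)))
      ((∫ ω, reTrace d (X ω * NormedSpace.exp (s • X ω)) ∂μ) * Real.exp (-(w * s ^ 2 / 2)) +
        m s * (Real.exp (-(w * s ^ 2 / 2)) * -(w * (2 * s) / 2))) s := by
    intro s
    have h1 : HasDerivAt (fun s : ℝ => -(w * s ^ 2 / 2)) (-(w * (2 * s) / 2)) s := by
      simpa using (((hasDerivAt_pow 2 s).const_mul w).div_const 2).fun_neg
    exact (hasDerivAt_integral_reTrace_exp hX hXb s).mul h1.exp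
  have hanti : AntitoneOn (fun s => m s * Real.exp (-(w * s ^ 2 / 2))) (Set.Icc 0 θ) := by
    refine antitoneOn_of_deriv_nonpos (convex_Icc 0 θ)
      (fun s _ => (hd s).continuousAt.continuousWithinAt)
      (fun s _ => (hd s).differentiableAt.differentiableWithinAt) fun s hs => ?_
    rw [interior_Icc] at hs
    rw [(hd s).deriv]
    have hs1 : κ * s ≤ κ * θ := mul_le_mul_of_nonneg_left hs.2.le hκ0.le
    have hpos' : 0 < 1 - κ * s := by linarith
    have h1 := integral_reTrace_sum_mul_exp_le hmeas hherm hindep hmean hR hbdd hs.1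
      (hs1.trans hθR.le)
    rw [← hκ, ← hv, mul_comm, ← le_div_iff₀ hpos'] at h1
    have h2 : s * v * m s / (1 - κ * s) ≤ w * s * m s := by
      have e : w * s * m s = s * v * m s / (1 - κ * θ) := by rw [hw]; ring
      rw [e]
      have hvs : 0 ≤ s * v * m s := mul_nonneg (mul_nonneg hs.1.le hv0) (hm0 s)
      have hle : 1 - κ * θ ≤ 1 - κ * s := by linarith
      gcongr
    have h3 := mul_le_mul_of_nonneg_right (h1.trans h2) (Real.exp_pos (-(w * s ^ 2 / 2))).le
    linarith
  have h := hanti (Set.left_mem_Icc.2 hθ) (Set.right_mem_Icc.2 hθ) hθ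
  have hzero : m 0 = d := by
    simp [hm, reTrace_apply, NormedSpace.exp_zero]
  simp only [hzero] at h
  rw [Real.exp_neg, ← div_eq_mul_inv, div_le_iff₀ (Real.exp_pos _)] at h
  refine h.trans_eq ?_
  rw [hw]
  norm_num
  left
  field_simp

/-! ### From trace exponentials to tail and mean -/

/-- The largest eigenvalue of a bounded random Hermitian matrix is integrable. -/
lemma integrable_lambdaMax {d : ℕ} (hd : 1 ≤ d) {Ω : Type*} [MeasurableSpace Ω] {μ : Measure Ω}
    [IsFiniteMeasure μ] {X : Ω → Matrix (Fin d) (Fin d) ℂ} (hX : Measurable X)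
    (hXh : ∀ ω, (X ω).IsHermitian) {B : ℝ} (hB : ∀ᵐ ω ∂μ, ‖X ω‖ ≤ B) :
    Integrable (fun ω => lambdaMax (X ω)) μ := by
  have h := integrable_continuous_comp_of_bounded
    (Φ := fun x => ‖x + algebraMap ℝ (Matrix (Fin d) (Fin d) ℂ) B‖ - B) (by fun_prop)
    hX.aestronglyMeasurable_matrix hB
  refine h.congr ?_
  filter_upwards [hB] with ω hω
  exact (lambdaMax_eq_norm_add_sub hd (hXh ω) hω).2.symm

lemma integrable_reTrace_exp {d : ℕ} {Ω : Type*} [MeasurableSpace Ω] {μ : Measure Ω}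
    [IsFiniteMeasure μ] {X : Ω → Matrix (Fin d) (Fin d) ℂ} (hX : Measurable X) {B : ℝ}
    (hB : ∀ᵐ ω ∂μ, ‖X ω‖ ≤ B) (θ : ℝ) :
    Integrable (fun ω => reTrace d (NormedSpace.exp (θ • X ω))) μ := by
  have hexp := continuous_matrix_exp (d := d)
  exact integrable_continuous_comp_of_bounded
    (Φ := fun x => reTrace d (NormedSpace.exp (θ • x))) (by fun_prop)
    hX.aestronglyMeasurable_matrix hB

/-- The matrix Chernoff bound. -/
lemma measureReal_le_lambdaMax_le {d : ℕ} (hd : 1 ≤ d) {Ω : Type*} [MeasurableSpace Ω]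
    {μ : Measure Ω} [IsFiniteMeasure μ] {X : Ω → Matrix (Fin d) (Fin d) ℂ} (hX : Measurable X)
    (hXh : ∀ ω, (X ω).IsHermitian) {B : ℝ} (hB : ∀ᵐ ω ∂μ, ‖X ω‖ ≤ B) {θ : ℝ} (hθ : 0 < θ)
    (t : ℝ) :
    μ.real {ω | t ≤ lambdaMax (X ω)} ≤
      Real.exp (-(θ * t)) * ∫ ω, reTrace d (NormedSpace.exp (θ • X ω)) ∂μ := by
  have h0 : ∀ ω, Real.exp (θ * lambdaMax (X ω)) ≤ reTrace d (NormedSpace.exp (θ • X ω)) :=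
    fun ω => exp_mul_lambdaMax_le hd (hXh ω) hθ
  have h1 := mul_meas_ge_le_integral_of_nonneg
    (.of_forall fun ω => (Real.exp_pos _).le.trans (h0 ω))
    (integrable_reTrace_exp hX hB θ) (Real.exp (θ * t))
  have h2 : μ.real {ω | t ≤ lambdaMax (X ω)} ≤
      μ.real {ω | Real.exp (θ * t) ≤ reTrace d (NormedSpace.exp (θ • X ω))} :=
    measureReal_mono fun ω hω =>
      (Real.exp_le_exp.2 (mul_le_mul_of_nonneg_left hω hθ.le)).trans (h0 ω)
  rw [Real.exp_neg, inv_mul_eq_div, le_div_iff₀' (Real.exp_pos _)]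
  exact (mul_le_mul_of_nonneg_left h2 (Real.exp_pos _).le).trans h1

/-- A bound `d exp g` on the trace exponential bounds the mean of the largest eigenvalue. The
concavity of the logarithm enters through `x ≤ L + exp (x - L) - 1`, with `L = log d + g`. -/
lemma mul_integral_lambdaMax_le {d : ℕ} (hd : 1 ≤ d) {Ω : Type*} [MeasurableSpace Ω]
    {μ : Measure Ω} [IsProbabilityMeasure μ] {X : Ω → Matrix (Fin d) (Fin d) ℂ} (hX : Measurable X)
    (hXh : ∀ ω, (X ω).IsHermitian) {B : ℝ} (hB : ∀ᵐ ω ∂μ, ‖X ω‖ ≤ B) {θ : ℝ} (hθ : 0 < θ) {g : ℝ}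
    (hg : ∫ ω, reTrace d (NormedSpace.exp (θ • X ω)) ∂μ ≤ d * Real.exp g) :
    θ * ∫ ω, lambdaMax (X ω) ∂μ ≤ Real.log d + g := by
  have hd0 : (0 : ℝ) < d := by exact_mod_cast hd
  have hpt : ∀ ω, θ * lambdaMax (X ω) ≤ Real.log d + g - 1 +
      reTrace d (NormedSpace.exp (θ • X ω)) * (d * Real.exp g)⁻¹ := by
    intro ω
    have h1 := Real.add_one_le_exp (θ * lambdaMax (X ω) - (Real.log d + g))
    rw [Real.exp_sub, Real.exp_add, Real.exp_log hd0, div_eq_mul_inv] at h1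
    have h2 := mul_le_mul_of_nonneg_right (exp_mul_lambdaMax_le hd (hXh ω) hθ)
      (by positivity : 0 ≤ (d * Real.exp g)⁻¹)
    linarith
  have hi := (integrable_reTrace_exp hX hB θ).mul_const (d * Real.exp g)⁻¹
  have h := integral_mono ((integrable_lambdaMax hd hX hXh hB).const_mul θ)
    ((integrable_const (Real.log d + g - 1)).add hi) hpt
  simp only [Pi.add_apply] at h
  rw [integral_const_mul, integral_add (integrable_const _) hi, integral_mul_const,
    integral_const, probReal_univ, one_smul] at h
  have h3 := mul_le_mul_of_nonneg_right hg (by positivity : 0 ≤ (d * Real.exp g)⁻¹)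
  rw [mul_inv_cancel₀ (by positivity)] at h3
  linarith

/-- The Laplace transform argument at `θ = t / (3 v / 2 + R t)`. -/
lemma bernstein_exponent_le {v R t : ℝ} (hv : 0 ≤ v) (hR : 0 < R) (ht : 0 < t) :
    ∃ θ, 0 < θ ∧ 3 * R / 4 * θ < 1 ∧
      -(θ * t) + v * θ ^ 2 / (2 * (1 - 3 * R / 4 * θ)) ≤ -t ^ 2 / (3 * v + 2 * R * t) := by
  have hRt : 0 < R * t := mul_pos hR ht
  set D := 3 / 2 * v + R * t with hD
  have hD0 : 0 < D := by positivity
  have e1 : 1 - 3 * R / 4 * (t / D) = (3 / 2 * v + R * t / 4) / D := by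
    field_simp
    rw [hD]; ring
  have hN : 0 < 3 / 2 * v + R * t / 4 := by positivity
  have hpos : 0 < 1 - 3 * R / 4 * (t / D) := by rw [e1]; positivity
  refine ⟨t / D, by positivity, by linarith, ?_⟩
  have e2 : v * (t / D) ^ 2 / (2 * (1 - 3 * R / 4 * (t / D))) =
      v / (3 / 2 * v + R * t / 4) * (t ^ 2 / (2 * D)) := by
    rw [e1]; field_simp
  have e3 : -t ^ 2 / (3 * v + 2 * R * t) = -(t ^ 2 / (2 * D)) := by
    rw [neg_div]; congr 2; rw [hD]; ring
  have e4 : t / D * t = 2 * (t ^ 2 / (2 * D)) := by field_simp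
  have h1 : v / (3 / 2 * v + R * t / 4) ≤ 1 := (div_le_one hN).2 (by linarith)
  have h2 : 0 ≤ t ^ 2 / (2 * D) := by positivity
  rw [e2, e3, e4]
  linarith [mul_le_mul_of_nonneg_right h1 h2]

/-- Optimization over `θ` of the bound `(L + g θ) / θ` on the mean. For `L > 0` the choice is
`1 / θ = R + σ / √L`; for `L = 0` the limit `θ → 0` is taken. -/
lemma bernstein_mean_le {σ R L x : ℝ} (hσ : 0 ≤ σ) (hR : 0 < R) (hL : 0 ≤ L)
    (hx : ∀ θ, 0 < θ → 3 * R / 4 * θ < 1 →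
      θ * x ≤ L + σ ^ 2 * θ ^ 2 / (2 * (1 - 3 * R / 4 * θ))) :
    x ≤ σ * √(3 * L) + R * L := by
  rcases hL.eq_or_lt with rfl | hL
  · simp only [mul_zero, Real.sqrt_zero, add_zero, zero_add] at hx ⊢
    by_contra! hx0
    -- On `(0, 1 / R]` the bound gives `x ≤ 2 σ ^ 2 θ`.
    obtain ⟨θ, hθ0, hθR, hθx⟩ : ∃ θ, 0 < θ ∧ R * θ ≤ 1 ∧ 2 * σ ^ 2 * θ < x := by
      refine ⟨min (1 / R) (x / (2 * σ ^ 2 + 1)), by positivity, ?_, ?_⟩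
      · calc R * min (1 / R) (x / (2 * σ ^ 2 + 1)) ≤ R * (1 / R) :=
            mul_le_mul_of_nonneg_left (min_le_left _ _) hR.le
          _ = 1 := by field_simp
      · calc 2 * σ ^ 2 * min (1 / R) (x / (2 * σ ^ 2 + 1))
            ≤ 2 * σ ^ 2 * (x / (2 * σ ^ 2 + 1)) :=
              mul_le_mul_of_nonneg_left (min_le_right _ _) (by positivity)
          _ < x := by
            rw [mul_div_assoc', div_lt_iff₀ (by positivity)]
            linarith
    have h := hx θ hθ0 (by linarith)
    have h2 : σ ^ 2 * θ ^ 2 / (2 * (1 - 3 * R / 4 * θ)) ≤ θ * (2 * σ ^ 2 * θ) := by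
      rw [div_le_iff₀ (by linarith)]
      nlinarith [mul_nonneg (sq_nonneg σ) (sq_nonneg θ)]
    have h3 := mul_lt_mul_of_pos_left hθx hθ0
    linarith
  · set s := √L with hs
    have hs0 : 0 < s := Real.sqrt_pos.2 hL
    have hsL : s ^ 2 = L := Real.sq_sqrt hL.le
    set q := σ / s with hq
    have hq0 : 0 ≤ q := by positivity
    have hσq : σ = q * s := by rw [hq]; field_simp
    have hRq : 0 < R + q := by linarith
    have hRq' : 0 < R / 4 + q := by linarith
    have e1 : 1 - 3 * R / 4 * (1 / (R + q)) = (R / 4 + q) / (R + q) := by field_simp; ring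
    have hpos : 0 < 1 - 3 * R / 4 * (1 / (R + q)) := by rw [e1]; positivity
    have h := hx (1 / (R + q)) (by positivity) (by linarith)
    have e2 : σ ^ 2 * (1 / (R + q)) ^ 2 / (2 * (1 - 3 * R / 4 * (1 / (R + q)))) =
        σ ^ 2 / (2 * (R / 4 + q)) * (1 / (R + q)) := by
      rw [e1]; field_simp
    rw [e2, one_div, inv_mul_eq_div, ← div_eq_mul_inv, div_le_iff₀ hRq, add_mul,
      div_mul_cancel₀ _ hRq.ne'] at h
    have h1 : σ ^ 2 / (2 * (R / 4 + q)) ≤ q * s ^ 2 / 2 := by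
      rw [div_le_iff₀ (by positivity), hσq]
      have : 0 ≤ q * s ^ 2 * R := by positivity
      nlinarith
    have h3 : 3 / 2 ≤ √3 := Real.le_sqrt_of_sq_le (by norm_num)
    have h4 : √(3 * L) = √3 * s := Real.sqrt_mul (by norm_num) L
    have h5 : 0 ≤ q * s ^ 2 := by positivity
    rw [h4, hσq]
    rw [← hsL] at h ⊢
    nlinarith [mul_le_mul_of_nonneg_right h3 h5]

theorem mainTheorem5 {Ω : Type*} [MeasurableSpace Ω] (μ : Measure Ω) [IsProbabilityMeasure μ]
    (d : ℕ) (hd : 1 ≤ d) (n : ℕ) (Y : Fin n → Ω → Matrix (Fin d) (Fin d) ℂ)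
    (hmeas : ∀ k, Measurable (Y k))
    (hherm : ∀ k ω, (Y k ω).IsHermitian)
    (hindep : iIndepFun Y μ)
    (hmean : ∀ k, ∫ ω, Y k ω ∂μ = 0)
    (R : ℝ) (hR : 0 ≤ R) (hbdd : ∀ k, ∀ᵐ ω ∂μ, ‖Y k ω‖ ≤ R)
    (σ : ℝ) (hσ : 0 ≤ σ) (hσ_sq : σ ^ 2 = ‖∑ k, ∫ ω, Y k ω ^ 2 ∂μ‖) :
    (∀ t : ℝ, 0 ≤ t →
      μ.real {ω | t ≤ lambdaMax (∑ k, Y k ω)} ≤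
          d * Real.exp (-t ^ 2 / (3 * σ ^ 2 + 2 * R * t)) ∧
      -- Lean reads `-t ^ 2 / 0` as `0`; for `t > 0` the exponent then means `-∞`.
      (0 < t → 3 * σ ^ 2 + 2 * R * t = 0 → μ.real {ω | t ≤ lambdaMax (∑ k, Y k ω)} = 0)) ∧
    Integrable (fun ω => lambdaMax (∑ k, Y k ω)) μ ∧
    ∫ ω, lambdaMax (∑ k, Y k ω) ∂μ ≤ σ * √(3 * Real.log d) + R * Real.log d := by
  have : SecondCountableTopology (Matrix (Fin d) (Fin d) ℂ) := secondCountable_of_proper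
  have hd0 : (1 : ℝ) ≤ d := by exact_mod_cast hd
  have hX : Measurable fun ω => ∑ k, Y k ω := Finset.measurable_fun_sum _ fun k _ => hmeas k
  have hXh : ∀ ω, (∑ k, Y k ω).IsHermitian := fun ω => isSelfAdjoint_sum _ (fun k _ => hherm k ω)
  have hXb : ∀ᵐ ω ∂μ, ‖∑ k, Y k ω‖ ≤ n * R := ae_norm_sum_le hbdd
  have hL : 0 ≤ Real.log d := Real.log_nonneg hd0
  have htriv : ∀ t, μ.real {ω | t ≤ lambdaMax (∑ k, Y k ω)} ≤ d := fun t =>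
    measureReal_le_one.trans hd0
  rcases hR.eq_or_lt with rfl | hR
  · -- For `R = 0` the sum vanishes almost surely.
    have hz : ∀ᵐ ω ∂μ, lambdaMax (∑ k, Y k ω) = 0 := by
      filter_upwards [hXb] with ω hω
      rw [mul_zero, norm_le_zero_iff] at hω
      rw [hω, (lambdaMax_eq_norm_add_sub hd Matrix.isHermitian_zero norm_zero.le).2]
      simp
    have htail : ∀ t, 0 < t → μ.real {ω | t ≤ lambdaMax (∑ k, Y k ω)} = 0 := fun t ht => by
      rw [measureReal_def, (measure_eq_zero_iff_ae_notMem).2, ENNReal.toReal_zero]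
      filter_upwards [hz] with ω hω
      simp [hω, ht]
    refine ⟨fun t ht => ⟨?_, fun ht0 _ => htail t ht0⟩, integrable_lambdaMax hd hX hXh hXb, ?_⟩
    · rcases ht.eq_or_lt with rfl | ht
      · simpa using htriv 0
      · rw [htail t ht]
        positivity
    · rw [integral_congr_ae hz, integral_zero]
      positivity
  · have hmgf := fun θ (hθ : 0 < θ) (hθR : 3 * R / 4 * θ < 1) =>
      integral_reTrace_exp_le hmeas hherm hindep hmean hR hbdd hθ.le hθR
    rw [← hσ_sq] at hmgf
    refine ⟨fun t ht => ⟨?_, fun ht0 h0 => ?_⟩, integrable_lambdaMax hd hX hXh hXb, ?_⟩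
    · rcases ht.eq_or_lt with rfl | ht
      · simpa using htriv 0
      · obtain ⟨θ, hθ, hθR, hle⟩ := bernstein_exponent_le (sq_nonneg σ) hR ht
        refine (measureReal_le_lambdaMax_le hd hX hXh hXb hθ t).trans ?_
        refine (mul_le_mul_of_nonneg_left (hmgf θ hθ hθR) (Real.exp_pos _).le).trans ?_
        rw [mul_left_comm, ← Real.exp_add]
        exact mul_le_mul_of_nonneg_left (Real.exp_le_exp.2 hle) (by positivity)
    · have : 0 < R * t := mul_pos hR ht0
      nlinarith [sq_nonneg σ]
    · exact bernstein_mean_le hσ hR hL fun θ hθ hθR =>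
        mul_integral_lambdaMax_le hd hX hXh hXb hθ (hmgf θ hθ hθR)
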